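/- Let $n\ge 1$ and let $\mathbb{H}^n=\{\xi=(x,y,t)=(z,t): z=(x,y)\in\mathbb{R}^n\times\mathbb{R}^n,\ t\in\mathbb{R}\}$ be the Heisenberg group with the law $\xi\circ\xi'=(x+x',\,y+y',\,t+t'+2\langle y,x'\rangle-2\langle x,y'\rangle)$, Lebesgue measure $d\xi$, gauge $d(\xi)=(|z|^4+t^2)^{1/4}$ and homogeneous dimension $Q=2n+2$. For real-valued $f\in C_c^1(\mathbb{H}^n)$ put $$[f]_{s,p,\alpha}=\left(\int_{\mathbb{H}^n}\int_{\mathbb{H}^n}\frac{|f(\xi)-f(\xi')|^p\,d\xi'\,d\xi}{d(\xi^{-1}\circ\xi')^{Q+ps}\,|z-z'|^{(p-2)\alpha}}\right)^{1/p}\in[0,\infty].$$ **Theorem 1.2.** Let $p>1$, $s\in(0,1)$, $\alpha\in\mathbb{R}$ with $0\le (p-2)\alpha<Q-2$, and let $\tau>1$, $0<a\le 1$, $\gamma\in\mathbb{R}$, $q\ge 1$ with $q>(1-a)\tau$ satisfy $$\frac1\tau+\frac{\gamma\left(1+(p-2)\frac{\alpha}{ps}\right)}{Q}=a\left(\frac1p-\frac{s\left(1+(p-2)\frac{\alpha}{ps}\right)}{Q}\right)+\frac{1-a}{q}\qquad\text{and}\qquad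 0\le-\gamma\le as.$$ Suppose moreover that $$\frac1\tau+\frac{\gamma\left(1+(p-2)\frac{\alpha}{ps}\right)}{Q}>0,\qquad \tau\gamma\le-2,\qquad q>\frac{(1-a)\tau Q}{Q-2+\tau\gamma(p-2)\frac{\alpha}{ps}}.$$ Then there is a constant $C<\infty$, depending only on $n,p,s,\alpha,\tau,a,\gamma,q$, such that $$\left(\int_{\mathbb{H}^n}d(\xi)^{\tau\gamma}\,|z|^{\tau\gamma(p-2)\frac{\alpha}{ps}}\,|f(\xi)|^\tau\,d\xi\right)^{1/\tau}\le C\,[f]_{s,p,\alpha}^{a}\,\|f\|_{L^q(\mathbb{H}^n)}^{1-a}\qquad\text{for all } f\in C_c^1(\mathbb{H}^n).$$ -/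

import Mathlib

open MeasureTheory
open scoped ENNReal NNReal

/-- The underlying set of the Heisenberg group `ℍⁿ`: the points `ξ = (x, y, t)` with
`x, y ∈ ℝⁿ` (Euclidean) and `t ∈ ℝ`; we write `z = (x, y)`. Its measure `volume` is the Lebesgue
measure of `ℝ²ⁿ⁺¹`, which is the Haar measure of the group. -/
abbrev Heis (n : ℕ) : Type :=
  EuclideanSpace ℝ (Fin n) × EuclideanSpace ℝ (Fin n) × ℝ

namespace Heis

/-- The group law
`(x, y, t) ∘ (x', y', t') = (x + x', y + y', t + t' + 2⟨y, x'⟩ - 2⟨x, y'⟩)`. -/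
noncomputable def op {n : ℕ} (ξ η : Heis n) : Heis n :=
  (ξ.1 + η.1, ξ.2.1 + η.2.1,
    ξ.2.2 + η.2.2 + 2 * inner ℝ ξ.2.1 η.1 - 2 * inner ℝ ξ.1 η.2.1)

/-- The inverse `ξ⁻¹ = -ξ` for the group law `op`. -/
noncomputable def inv {n : ℕ} (ξ : Heis n) : Heis n := -ξ

/-- The Euclidean length `|z| = (|x|² + |y|²)^(1/2)` of the horizontal part `z = (x, y)`
of `ξ = (z, t)`. -/
noncomputable def horiz {n : ℕ} (ξ : Heis n) : ℝ :=
  Real.sqrt (‖ξ.1‖ ^ 2 + ‖ξ.2.1‖ ^ 2)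

/-- The Korányi-Folland gauge `d(ξ) = (|z|⁴ + t²)^(1/4)`. -/
noncomputable def gauge {n : ℕ} (ξ : Heis n) : ℝ :=
  (horiz ξ ^ 4 + ξ.2.2 ^ 2) ^ (1 / 4 : ℝ)

/-- The homogeneous dimension `Q = 2n + 2`. -/
noncomputable def Q (n : ℕ) : ℝ := 2 * (n : ℝ) + 2

/-- The fractional seminorm, with values in `[0, ∞]`,
`[f]_{s,p,α} = (∬ |f(ξ) - f(ξ')|^p / (d(ξ⁻¹ ∘ ξ')^{Q+ps} |z - z'|^{(p-2)α}) dξ' dξ)^{1/p}`. -/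
noncomputable def seminorm {n : ℕ} (s p α : ℝ) (f : Heis n → ℝ) : ℝ≥0∞ :=
  (∫⁻ ξ : Heis n, ∫⁻ ξ' : Heis n,
    ‖f ξ - f ξ'‖ₑ ^ p /
      (ENNReal.ofReal (gauge (op (inv ξ) ξ')) ^ (Q n + p * s) *
        ENNReal.ofReal (horiz (ξ - ξ')) ^ ((p - 2) * α))) ^ (1 / p)

/-- The weighted norm, with values in `[0, ∞]`,
`(∫ d(ξ)^{τγ} |z|^{τγ(p-2)α/(ps)} |f(ξ)|^τ dξ)^{1/τ}`. -/
noncomputable def weightedNorm {n : ℕ} (s p α τ γ : ℝ) (f : Heis n → ℝ) : ℝ≥0∞ :=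
  (∫⁻ ξ : Heis n,
    ENNReal.ofReal (gauge ξ) ^ (τ * γ) *
      ENNReal.ofReal (horiz ξ) ^ (τ * γ * ((p - 2) * α / (p * s))) *
      ‖f ξ‖ₑ ^ τ) ^ (1 / τ)

end Heis

/-!
The inequality is reduced to a statement about the measures `m k` of the dyadic superlevel sets
`{2 ^ k < |f|}` and the measures `d k` of the layers `{2 ^ k < |f| ≤ 2 ^ (k + 1)}`. Three facts enter.

* The weight `d ^ (τγ) |z| ^ (τγκ)`, with `κ = (p - 2) α / (p s)`, is homogeneous of some degree
  `-Q (1 - ω)` with `0 < ω ≤ 1` and lies in the corresponding weak Lebesgue space: its integral over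
  a set `E` is at most a constant times `|E| ^ ω` (`exists_setLIntegral_weight_le`). The hypothesis
  `τγ ≤ -2` together with the positivity of `ω` gives `κ < n`, which is what makes the set where the
  weight exceeds `1` thin enough near the axis `z = 0`. Consequently the left side is at most a
  constant times `∑ 2 ^ (k τ) (d k) ^ ω`.
* If `|f ξ| > 2 ^ k`, then `|f| ≤ 2 ^ (k - 1)` on at least half of a ball around `ξ` whose volume is
  comparable to `m (k - 1)`. Hence `2 ^ (k p) d k` is at most a constant times
  `m (k - 1) ^ e * g k`, where `e = (p s + (p - 2) α) / Q` and `g k` is the part of the energy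
  `[f] ^ p` carried by the points `ξ` of the layer (`exists_volume_layer_le`).
* `∑ 2 ^ (k q) d k` is at most the `q`-th power of the `L ^ q` norm.

What remains is an inequality between sequences (`exists_tsum_layers_le`). Since
`m k ≤ d k + m (k + 1)`, dyadic sums over superlevel sets and over layers are comparable. With
`A = a τ / p` and `B = (1 - a) τ / q`, the balance condition reads `ω = A + B - e A`, and
`-γ ≤ a s` reads `A + B ≥ 1`, so that Hölder's inequality for series applies. If `ω < A`, the second
fact is used to the power `ω` only, and the remaining power of `m (k - 1)` is split between the
`q`-sum and the sum to be estimated; the latter appears with an exponent below `1` and is absorbed.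
The sign of `1 / p - s (1 + κ) / Q` plays no role.
-/

namespace Heis

variable {n : ℕ}

/-! ### Inequalities for series -/

theorem tsum_rpow_le_rpow_tsum {ι : Type*} (u : ι → ℝ≥0∞) {S : ℝ} (hS : 1 ≤ S) :
    ∑' i, u i ^ S ≤ (∑' i, u i) ^ S := by
  have key : ∀ x : ℝ≥0∞, x ^ S = x * x ^ (S - 1) := fun x => by
    conv_lhs => rw [show S = 1 + (S - 1) by ring]
    rw [ENNReal.rpow_add_of_nonneg _ _ zero_le_one (by linarith), ENNReal.rpow_one]
  calc ∑' i, u i ^ S ≤ ∑' i, u i * (∑' j, u j) ^ (S - 1) := by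
        refine ENNReal.tsum_le_tsum fun i => ?_
        rw [key]
        gcongr
        exact ENNReal.le_tsum i
    _ = (∑' i, u i) ^ S := by rw [ENNReal.tsum_mul_right, ← key]

/-- Hölder's inequality for series with three factors, in the range where the exponents add up to
at least `1`; the excess over `1` is harmless for series, since `ℓ¹ ⊆ ℓ^S` for `S ≥ 1`. -/
theorem tsum_mul_rpow_le {ι : Type*} (x y z : ι → ℝ≥0∞) {a b c : ℝ} (ha : 0 ≤ a) (hb : 0 ≤ b)
    (hc : 0 ≤ c) (habc : 1 ≤ a + b + c) :
    ∑' i, x i ^ a * y i ^ b * z i ^ c ≤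
      (∑' i, x i) ^ a * (∑' i, y i) ^ b * (∑' i, z i) ^ c := by
  set S := a + b + c with hS
  have hS0 : 0 < S := by linarith
  have hmul : ∀ x y z : ℝ≥0∞,
      (x ^ (a / S) * y ^ (b / S) * z ^ (c / S)) ^ S = x ^ a * y ^ b * z ^ c := by
    intro x y z
    rw [ENNReal.mul_rpow_of_nonneg _ _ hS0.le, ENNReal.mul_rpow_of_nonneg _ _ hS0.le,
      ← ENNReal.rpow_mul, ← ENNReal.rpow_mul, ← ENNReal.rpow_mul, div_mul_cancel₀ _ hS0.ne',
      div_mul_cancel₀ _ hS0.ne', div_mul_cancel₀ _ hS0.ne']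
  let _ : MeasurableSpace ι := ⊤
  have holder : ∑' i, x i ^ (a / S) * y i ^ (b / S) * z i ^ (c / S) ≤
      (∑' i, x i) ^ (a / S) * (∑' i, y i) ^ (b / S) * (∑' i, z i) ^ (c / S) := by
    have h := ENNReal.lintegral_prod_norm_pow_le (μ := Measure.count) (Finset.univ : Finset (Fin 3))
      (f := ![x, y, z]) (p := ![a / S, b / S, c / S])
      (fun i _ => (Measurable.of_discrete).aemeasurable)
      (by
        simp only [Fin.sum_univ_three, Matrix.cons_val_zero, Matrix.cons_val_one, Matrix.cons_val]
        rw [← add_div, ← add_div, ← hS, div_self hS0.ne'])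
      (fun i _ => by fin_cases i <;> simp <;> positivity)
    simpa [Fin.prod_univ_three, lintegral_count] using h
  calc ∑' i, x i ^ a * y i ^ b * z i ^ c
      = ∑' i, (x i ^ (a / S) * y i ^ (b / S) * z i ^ (c / S)) ^ S := by simp_rw [hmul]
    _ ≤ _ := tsum_rpow_le_rpow_tsum _ habc
    _ ≤ _ := ENNReal.rpow_le_rpow holder hS0.le
    _ = _ := hmul _ _ _

theorem le_rpow_of_le_mul_rpow {x K : ℝ≥0∞} {θ : ℝ} (hx : x ≠ ∞) (hθ : 0 < θ) (hθ1 : θ ≤ 1)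
    (h : x ≤ K * x ^ (1 - θ)) : x ≤ K ^ (1 / θ) := by
  rcases eq_or_ne x 0 with rfl | hx0
  · exact zero_le
  have h1 : x = x ^ θ * x ^ (1 - θ) := by
    rw [← ENNReal.rpow_add _ _ hx0 hx, add_sub_cancel, ENNReal.rpow_one]
  have h2 : x ^ θ ≤ K := by
    conv_lhs at h => rw [h1]
    refine (ENNReal.mul_le_mul_iff_left ?_ ?_).1 h
    · exact (ENNReal.rpow_pos (pos_iff_ne_zero.2 hx0) hx).ne'
    · exact ENNReal.rpow_ne_top_of_nonneg (by linarith) hx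
  calc x = (x ^ θ) ^ (1 / θ) := by
        rw [← ENNReal.rpow_mul, mul_one_div_cancel hθ.ne', ENNReal.rpow_one]
    _ ≤ K ^ (1 / θ) := ENNReal.rpow_le_rpow h2 (by positivity)

theorem two_rpow_add (x y : ℝ) : (2 : ℝ≥0∞) ^ (x + y) = 2 ^ x * 2 ^ y :=
  ENNReal.rpow_add _ _ two_ne_zero ENNReal.ofNat_ne_top

theorem two_rpow_ne_top (x : ℝ) : (2 : ℝ≥0∞) ^ x ≠ ∞ :=
  ENNReal.rpow_ne_top_of_ne_zero two_ne_zero ENNReal.ofNat_ne_top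

theorem two_rpow_ne_zero (x : ℝ) : (2 : ℝ≥0∞) ^ x ≠ 0 :=
  (ENNReal.rpow_pos two_pos ENNReal.ofNat_ne_top).ne'

theorem two_rpow_neg_lt_one {τ : ℝ} (hτ : 0 < τ) : (2 : ℝ≥0∞) ^ (-τ) < 1 :=
  ENNReal.rpow_lt_one_of_one_lt_of_neg (by norm_num) (by linarith)

/-- A dyadic sum over level sets is controlled by the same sum over the layers between consecutive
levels: shifting the index gains the factor `2 ^ (-τ) < 1`, so the tail can be absorbed. -/
theorem tsum_levels_le_tsum_layers {m d : ℤ → ℝ≥0∞} {τ ω : ℝ} (hτ : 0 < τ) (hω : 0 ≤ ω)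
    (hω1 : ω ≤ 1) (hmd : ∀ k, m k ≤ d k + m (k + 1))
    (hfin : ∑' k : ℤ, (2 : ℝ≥0∞) ^ (k * τ) * m k ^ ω ≠ ∞) :
    ∑' k : ℤ, (2 : ℝ≥0∞) ^ (k * τ) * m k ^ ω ≤
      (1 - (2 : ℝ≥0∞) ^ (-τ))⁻¹ * ∑' k : ℤ, (2 : ℝ≥0∞) ^ (k * τ) * d k ^ ω := by
  set L := ∑' k : ℤ, (2 : ℝ≥0∞) ^ (k * τ) * m k ^ ω with hL
  set D := ∑' k : ℤ, (2 : ℝ≥0∞) ^ (k * τ) * d k ^ ω with hD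
  have hshift : ∑' k : ℤ, (2 : ℝ≥0∞) ^ (k * τ) * m (k + 1) ^ ω = 2 ^ (-τ) * L := by
    rw [hL, ← ENNReal.tsum_mul_left,
      ← (Equiv.addRight (1 : ℤ)).tsum_eq fun k : ℤ => 2 ^ (-τ) * (2 ^ (k * τ) * m k ^ ω)]
    refine tsum_congr fun k => ?_
    simp only [Equiv.coe_addRight]
    rw [← mul_assoc, ← two_rpow_add]
    push_cast
    ring_nf
  have h1 : L ≤ D + 2 ^ (-τ) * L := by
    rw [← hshift, hD, ← ENNReal.tsum_add]
    refine ENNReal.tsum_le_tsum fun k => ?_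
    rw [← mul_add]
    gcongr
    exact (ENNReal.rpow_le_rpow (hmd k) hω).trans (ENNReal.rpow_add_le_add_rpow _ _ hω hω1)
  have hlt := two_rpow_neg_lt_one hτ
  have h2 : (1 - (2 : ℝ≥0∞) ^ (-τ)) * L ≤ D := by
    rw [ENNReal.sub_mul (fun _ _ => hfin), one_mul]
    exact tsub_le_iff_right.2 h1
  have hne : 1 - (2 : ℝ≥0∞) ^ (-τ) ≠ 0 := (tsub_pos_of_lt hlt).ne'
  have hnt : 1 - (2 : ℝ≥0∞) ^ (-τ) ≠ ∞ := ENNReal.sub_ne_top ENNReal.one_ne_top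
  calc L = (1 - (2 : ℝ≥0∞) ^ (-τ))⁻¹ * ((1 - (2 : ℝ≥0∞) ^ (-τ)) * L) := by
        rw [← mul_assoc, ENNReal.inv_mul_cancel hne hnt, one_mul]
    _ ≤ _ := by gcongr

theorem inv_one_sub_two_rpow_neg_ne_top {τ : ℝ} (hτ : 0 < τ) :
    (1 - (2 : ℝ≥0∞) ^ (-τ))⁻¹ ≠ ∞ :=
  ENNReal.inv_ne_top.2 (tsub_pos_of_lt (two_rpow_neg_lt_one hτ)).ne'

theorem tsum_two_rpow_mul_pred (u : ℤ → ℝ≥0∞) (r : ℝ) :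
    ∑' k : ℤ, (2 : ℝ≥0∞) ^ (k * r) * u (k - 1) =
      2 ^ r * ∑' k : ℤ, (2 : ℝ≥0∞) ^ (k * r) * u k := by
  rw [← ENNReal.tsum_mul_left, ← (Equiv.addRight (1 : ℤ)).tsum_eq]
  refine tsum_congr fun k => ?_
  simp only [Equiv.coe_addRight, add_sub_cancel_right]
  rw [← mul_assoc, ← two_rpow_add]
  push_cast
  ring_nf

/-- The discrete form of the interpolation inequality. Here `m k` stands for the measure of
`{2 ^ k < |f|}`, `d k` for the measure of `{2 ^ k < |f| ≤ 2 ^ (k + 1)}` and `g k` for the share of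
that layer in the fractional energy. If `ω < A` the left side also occurs, with a power below `1`,
on the right side of the estimate and is absorbed. -/
theorem exists_tsum_layers_le {p q τ ω A B e : ℝ} (hτ : 0 < τ)
    (hω : 0 < ω) (hω1 : ω ≤ 1) (hA : 0 < A) (hB : 0 ≤ B) (hAB : 1 ≤ A + B) (he : 0 ≤ e)
    (hτe : p * A + q * B = τ) (hωe : ω = A + B - e * A) {C : ℝ≥0∞} (hC : C ≠ ∞) :
    ∃ K : ℝ≥0, ∀ m d g : ℤ → ℝ≥0∞, Antitone m → (∀ k, d k ≤ m k) →
      (∀ k, m k ≤ d k + m (k + 1)) →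
      (∀ k, d k ≤ C * 2 ^ (-(k * p)) * m (k - 1) ^ e * g k) →
      ∑' k : ℤ, (2 : ℝ≥0∞) ^ (k * τ) * m k ^ ω ≠ ∞ →
      ∑' k : ℤ, (2 : ℝ≥0∞) ^ (k * τ) * d k ^ ω ≤
        K * (∑' k, g k) ^ A * (∑' k : ℤ, (2 : ℝ≥0∞) ^ (k * q) * m k) ^ B := by
  have hbase : ∀ (θ : ℝ), 0 ≤ θ → ∀ (m d g : ℤ → ℝ≥0∞),
      (∀ k, d k ≤ C * 2 ^ (-(k * p)) * m (k - 1) ^ e * g k) → ∀ k : ℤ,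
      d k ^ θ ≤ C ^ θ * 2 ^ (-(k * p * θ)) * m (k - 1) ^ (e * θ) * g k ^ θ := by
    intro θ hθ m d g h k
    refine (ENNReal.rpow_le_rpow (h k) hθ).trans_eq ?_
    rw [ENNReal.mul_rpow_of_nonneg _ _ hθ, ENNReal.mul_rpow_of_nonneg _ _ hθ,
      ENNReal.mul_rpow_of_nonneg _ _ hθ, ← ENNReal.rpow_mul, ← ENNReal.rpow_mul, neg_mul]
  rcases le_or_gt A ω with hAω | hAω
  -- `d ^ ω = d ^ A * d ^ (ω - A)`, with the energy bound for the first factor and `d ≤ m` for the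
  -- second
  · have hK : C ^ A * 2 ^ (q * B) ≠ ∞ :=
      ENNReal.mul_ne_top (ENNReal.rpow_ne_top_of_nonneg hA.le hC) (two_rpow_ne_top _)
    refine ⟨(C ^ A * 2 ^ (q * B)).toNNReal, fun m d g hm hdm hmd hdg hfin => ?_⟩
    rw [ENNReal.coe_toNNReal hK]
    have hterm : ∀ k : ℤ, (2 : ℝ≥0∞) ^ (k * τ) * d k ^ ω ≤
        C ^ A * (g k ^ A * (2 ^ (k * q) * m (k - 1)) ^ B * 1 ^ (0 : ℝ)) := by
      intro k
      have h1 : d k ^ (ω - A) ≤ m (k - 1) ^ (ω - A) :=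
        ENNReal.rpow_le_rpow ((hdm k).trans (hm (by omega))) (by linarith)
      calc (2 : ℝ≥0∞) ^ (k * τ) * d k ^ ω
          = 2 ^ (k * τ) * (d k ^ A * d k ^ (ω - A)) := by
            rw [← ENNReal.rpow_add_of_nonneg _ _ hA.le (by linarith), add_sub_cancel]
        _ ≤ 2 ^ (k * τ) * ((C ^ A * 2 ^ (-(k * p * A)) * m (k - 1) ^ (e * A) * g k ^ A) *
              m (k - 1) ^ (ω - A)) := by
            gcongr
            exact hbase A hA.le m d g hdg k
        _ = C ^ A * (g k ^ A * ((2 ^ (k * τ) * 2 ^ (-(k * p * A))) *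
              (m (k - 1) ^ (e * A) * m (k - 1) ^ (ω - A)))) := by ring
        _ = _ := by
            rw [← two_rpow_add, ← ENNReal.rpow_add_of_nonneg _ _ (by positivity) (by linarith),
              ENNReal.one_rpow, mul_one, ENNReal.mul_rpow_of_nonneg _ _ hB, ← ENNReal.rpow_mul]
            congr 4
            · rw [← hτe]; ring
            · rw [hωe]; ring
    calc ∑' k : ℤ, (2 : ℝ≥0∞) ^ (k * τ) * d k ^ ω
        ≤ C ^ A * ∑' k : ℤ, g k ^ A * (2 ^ (k * q) * m (k - 1)) ^ B * 1 ^ (0 : ℝ) := by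
          rw [← ENNReal.tsum_mul_left]
          exact ENNReal.tsum_le_tsum hterm
      _ ≤ C ^ A * ((∑' k, g k) ^ A * (∑' k : ℤ, (2 : ℝ≥0∞) ^ (k * q) * m (k - 1)) ^ B *
            (∑' _ : ℤ, (1 : ℝ≥0∞)) ^ (0 : ℝ)) := by
          gcongr
          exact tsum_mul_rpow_le _ _ _ hA.le hB le_rfl (by linarith)
      _ = _ := by
          rw [tsum_two_rpow_mul_pred, ENNReal.rpow_zero, mul_one,
            ENNReal.mul_rpow_of_nonneg _ _ hB, ← ENNReal.rpow_mul]
          ring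
  -- the energy bound is used for the whole of `d ^ ω`
  · set θ := ω / A with hθ
    have hθ0 : 0 < θ := by positivity
    have hθ1 : θ < 1 := (div_lt_one hA).2 hAω
    have hωθ : ω = θ * A := by rw [hθ]; field_simp
    clear_value θ
    set c := (1 - (2 : ℝ≥0∞) ^ (-τ))⁻¹ with hc
    have hcT : c ≠ ∞ := inv_one_sub_two_rpow_neg_ne_top hτ
    set K := C ^ ω * (2 ^ q) ^ (θ * B) * (2 ^ τ * c) ^ (1 - θ) with hKdef
    have hK : K ^ (1 / θ) ≠ ∞ := by
      refine ENNReal.rpow_ne_top_of_nonneg (by positivity) ?_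
      refine ENNReal.mul_ne_top (ENNReal.mul_ne_top ?_ ?_) ?_
      · exact ENNReal.rpow_ne_top_of_nonneg hω.le hC
      · exact ENNReal.rpow_ne_top_of_nonneg (by positivity) (two_rpow_ne_top _)
      · exact ENNReal.rpow_ne_top_of_nonneg (by linarith)
          (ENNReal.mul_ne_top (two_rpow_ne_top _) hcT)
    refine ⟨(K ^ (1 / θ)).toNNReal, fun m d g hm hdm hmd hdg hfin => ?_⟩
    rw [ENNReal.coe_toNNReal hK]
    set G := ∑' k, g k
    set I := ∑' k : ℤ, (2 : ℝ≥0∞) ^ (k * q) * m k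
    set L := ∑' k : ℤ, (2 : ℝ≥0∞) ^ (k * τ) * m k ^ ω
    set D := ∑' k : ℤ, (2 : ℝ≥0∞) ^ (k * τ) * d k ^ ω
    have hDL : D ≤ L := ENNReal.tsum_le_tsum fun k => by
      gcongr
      exact hdm k
    have hLD : L ≤ c * D := tsum_levels_le_tsum_layers hτ hω.le hω1 hmd hfin
    have hterm : ∀ k : ℤ, (2 : ℝ≥0∞) ^ (k * τ) * d k ^ ω ≤
        C ^ ω * (g k ^ ω * (2 ^ (k * q) * m (k - 1)) ^ (θ * B) *
          (2 ^ (k * τ) * m (k - 1) ^ ω) ^ (1 - θ)) := by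
      intro k
      calc (2 : ℝ≥0∞) ^ (k * τ) * d k ^ ω
          ≤ 2 ^ (k * τ) * (C ^ ω * 2 ^ (-(k * p * ω)) * m (k - 1) ^ (e * ω) * g k ^ ω) := by
            gcongr
            exact hbase ω hω.le m d g hdg k
        _ = C ^ ω * (g k ^ ω * ((2 ^ (k * τ) * 2 ^ (-(k * p * ω))) * m (k - 1) ^ (e * ω))) := by
            ring
        _ = C ^ ω * (g k ^ ω * ((2 ^ (k * q * (θ * B)) * 2 ^ (k * τ * (1 - θ))) *
              (m (k - 1) ^ (θ * B) * m (k - 1) ^ (ω * (1 - θ))))) := by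
            rw [← two_rpow_add, ← two_rpow_add,
              ← ENNReal.rpow_add_of_nonneg _ _ (by positivity)
                (mul_nonneg hω.le (by linarith))]
            congr 4
            · rw [← hτe, hωθ]; ring
            · linear_combination e * hωθ + θ * hωe - hωθ
        _ = _ := by
            rw [ENNReal.mul_rpow_of_nonneg _ _ (by positivity : 0 ≤ θ * B),
              ENNReal.mul_rpow_of_nonneg _ _ (by linarith : 0 ≤ 1 - θ), ← ENNReal.rpow_mul,
              ← ENNReal.rpow_mul, ← ENNReal.rpow_mul]
            ring
    have hmain : D ≤ K * G ^ ω * I ^ (θ * B) * D ^ (1 - θ) := by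
      calc D ≤ C ^ ω * ∑' k : ℤ, g k ^ ω * (2 ^ (k * q) * m (k - 1)) ^ (θ * B) *
              (2 ^ (k * τ) * m (k - 1) ^ ω) ^ (1 - θ) := by
            rw [← ENNReal.tsum_mul_left]
            exact ENNReal.tsum_le_tsum hterm
        _ ≤ C ^ ω * (G ^ ω * (∑' k : ℤ, (2 : ℝ≥0∞) ^ (k * q) * m (k - 1)) ^ (θ * B) *
              (∑' k : ℤ, (2 : ℝ≥0∞) ^ (k * τ) * m (k - 1) ^ ω) ^ (1 - θ)) := by
            gcongr
            refine tsum_mul_rpow_le _ _ _ hω.le (by positivity) (by linarith) ?_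
            nlinarith
        _ = C ^ ω * (G ^ ω * (2 ^ q * I) ^ (θ * B) * (2 ^ τ * L) ^ (1 - θ)) := by
            rw [tsum_two_rpow_mul_pred, tsum_two_rpow_mul_pred (fun k => m k ^ ω)]
        _ ≤ C ^ ω * (G ^ ω * (2 ^ q * I) ^ (θ * B) * (2 ^ τ * (c * D)) ^ (1 - θ)) := by
            have : (2 ^ τ * L) ^ (1 - θ) ≤ (2 ^ τ * (c * D)) ^ (1 - θ) :=
              ENNReal.rpow_le_rpow (by gcongr) (by linarith)
            gcongr
        _ = K * G ^ ω * I ^ (θ * B) * D ^ (1 - θ) := by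
            rw [← mul_assoc (2 ^ τ) c D, ENNReal.mul_rpow_of_nonneg _ D (by linarith : 0 ≤ 1 - θ),
              ENNReal.mul_rpow_of_nonneg _ I (by positivity : 0 ≤ θ * B), hKdef]
            ring
    refine (le_rpow_of_le_mul_rpow (ne_top_of_le_ne_top hfin hDL) hθ0 hθ1.le hmain).trans_eq ?_
    have h0 : 0 ≤ 1 / θ := by positivity
    rw [ENNReal.mul_rpow_of_nonneg _ _ h0, ENNReal.mul_rpow_of_nonneg _ _ h0, ← ENNReal.rpow_mul,
      ← ENNReal.rpow_mul]
    congr 3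
    · rw [hωθ]; field_simp
    · field_simp

/-! ### The gauge and dilations -/


theorem horiz_nonneg (ξ : Heis n) : 0 ≤ horiz ξ := Real.sqrt_nonneg _

theorem gauge_nonneg (ξ : Heis n) : 0 ≤ gauge ξ := Real.rpow_nonneg (by positivity) _

theorem horiz_sq (ξ : Heis n) : horiz ξ ^ 2 = ‖ξ.1‖ ^ 2 + ‖ξ.2.1‖ ^ 2 :=
  Real.sq_sqrt (by positivity)

theorem gauge_pow_four (ξ : Heis n) : gauge ξ ^ 4 = horiz ξ ^ 4 + ξ.2.2 ^ 2 := by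
  rw [gauge, ← Real.rpow_natCast, ← Real.rpow_mul (by positivity)]
  norm_num

theorem horiz_le_gauge (ξ : Heis n) : horiz ξ ≤ gauge ξ := by
  refine le_of_pow_le_pow_left₀ (n := 4) (by norm_num) (gauge_nonneg ξ) ?_
  rw [gauge_pow_four]
  nlinarith [sq_nonneg ξ.2.2]

theorem abs_le_gauge_sq (ξ : Heis n) : |ξ.2.2| ≤ gauge ξ ^ 2 := by
  refine abs_le_of_sq_le_sq ?_ (by positivity)
  rw [← pow_mul, gauge_pow_four]
  nlinarith [pow_nonneg (horiz_nonneg ξ) 4]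

theorem norm_fst_le_horiz (ξ : Heis n) : ‖ξ.1‖ ≤ horiz ξ :=
  Real.le_sqrt_of_sq_le (by nlinarith [sq_nonneg ‖ξ.2.1‖])

theorem norm_snd_le_horiz (ξ : Heis n) : ‖ξ.2.1‖ ≤ horiz ξ :=
  Real.le_sqrt_of_sq_le (by nlinarith [sq_nonneg ‖ξ.1‖])

@[fun_prop]
theorem measurable_horiz : Measurable (horiz : Heis n → ℝ) := by
  unfold horiz
  fun_prop

@[fun_prop]
theorem measurable_gauge : Measurable (gauge : Heis n → ℝ) := by
  unfold gauge
  fun_prop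

theorem Q_pos : 0 < Q n := by
  unfold Q
  positivity

/-- The anisotropic dilation `(x, y, t) ↦ (r x, r y, r² t)`, for which the gauge is homogeneous of
degree `1` and Lebesgue measure is homogeneous of degree `Q`. -/
noncomputable def dilation (r : ℝ) (ξ : Heis n) : Heis n :=
  (r • ξ.1, r • ξ.2.1, r ^ 2 • ξ.2.2)

theorem horiz_dilation {r : ℝ} (hr : 0 ≤ r) (ξ : Heis n) : horiz (dilation r ξ) = r * horiz ξ := by
  refine (pow_left_inj₀ (horiz_nonneg _) (mul_nonneg hr (horiz_nonneg _)) two_ne_zero).1 ?_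
  rw [mul_pow, horiz_sq, horiz_sq]
  simp only [dilation, norm_smul, Real.norm_eq_abs, mul_pow, sq_abs]
  ring

theorem gauge_dilation {r : ℝ} (hr : 0 ≤ r) (ξ : Heis n) : gauge (dilation r ξ) = r * gauge ξ := by
  refine (pow_left_inj₀ (gauge_nonneg _) (mul_nonneg hr (gauge_nonneg _)) four_ne_zero).1 ?_
  rw [mul_pow, gauge_pow_four, gauge_pow_four, horiz_dilation hr]
  simp only [dilation, smul_eq_mul]
  ring

theorem ofReal_rpow_Q {r : ℝ} (hr : 0 < r) :
    ENNReal.ofReal r ^ Q n =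
      ENNReal.ofReal (r ^ n) * (ENNReal.ofReal (r ^ n) * ENNReal.ofReal (r ^ 2)) := by
  rw [ENNReal.ofReal_rpow_of_pos hr, ← ENNReal.ofReal_mul (by positivity),
    ← ENNReal.ofReal_mul (by positivity), Q]
  congr 1
  rw [show (2 * (n : ℝ) + 2) = ((n + (n + 2) : ℕ) : ℝ) by push_cast; ring, Real.rpow_natCast]
  ring

theorem lintegral_comp_dilation {r : ℝ} (hr : 0 < r) {F : Heis n → ℝ≥0∞} (hF : Measurable F) :
    ∫⁻ ξ, F ξ = ENNReal.ofReal r ^ Q n * ∫⁻ ξ, F (dilation r ξ) := by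
  have hmap : ∀ {E : Type} [NormedAddCommGroup E] [NormedSpace ℝ E] [MeasurableSpace E]
      [BorelSpace E] [FiniteDimensional ℝ E] (μ : Measure E) [μ.IsAddHaarMeasure] {c : ℝ}
      (_ : 0 < c), μ = ENNReal.ofReal (c ^ Module.finrank ℝ E) • μ.map (c • ·) := by
    intro E _ _ _ _ _ μ _ c hc
    rw [Measure.map_addHaar_smul μ hc.ne', smul_smul, ← ENNReal.ofReal_mul (by positivity),
      abs_of_pos (by positivity), mul_inv_cancel₀ (by positivity), ENNReal.ofReal_one, one_smul]
  have hE := hmap (volume : Measure (EuclideanSpace ℝ (Fin n))) hr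
  have hR := hmap (volume : Measure ℝ) (c := r ^ 2) (by positivity)
  rw [finrank_euclideanSpace_fin] at hE
  rw [Module.finrank_self, pow_one] at hR
  have hm1 : Measurable fun x : EuclideanSpace ℝ (Fin n) => r • x := by fun_prop
  have hm2 : Measurable fun t : ℝ => r ^ 2 • t := by fun_prop
  have hvol : (volume : Measure (Heis n)) =
      (ENNReal.ofReal r ^ Q n) • (volume : Measure (Heis n)).map (dilation r) := by
    have h2 : (volume : Measure (EuclideanSpace ℝ (Fin n) × ℝ)) =
        (ENNReal.ofReal (r ^ n) * ENNReal.ofReal (r ^ 2)) •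
          (volume : Measure (EuclideanSpace ℝ (Fin n) × ℝ)).map
            (Prod.map (r • ·) (r ^ 2 • ·)) := by
      rw [Measure.volume_eq_prod, ← Measure.map_prod_map _ _ hm1 hm2]
      conv_lhs => rw [hE, hR]
      rw [Measure.prod_smul_left, Measure.prod_smul_right, smul_smul]
    have h3 : dilation (n := n) r = Prod.map (r • ·) (Prod.map (r • ·) (r ^ 2 • ·)) := rfl
    rw [h3, Measure.volume_eq_prod, ← Measure.map_prod_map _ _ hm1 (hm1.prodMap hm2)]
    conv_lhs => rw [hE, h2]
    rw [Measure.prod_smul_left, Measure.prod_smul_right, smul_smul, ofReal_rpow_Q hr]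
  have hmd : Measurable (dilation (n := n) r) := hm1.prodMap (hm1.prodMap hm2)
  conv_lhs => rw [hvol]
  rw [lintegral_smul_measure, lintegral_map hF hmd, smul_eq_mul]

/-! ### Integrability of powers of the norm -/

theorem lintegral_ball_rpow_neg_lt_top {E : Type*} [NormedAddCommGroup E] [NormedSpace ℝ E]
    [FiniteDimensional ℝ E] [MeasurableSpace E] [BorelSpace E] (μ : Measure E)
    [μ.IsAddHaarMeasure] {c : ℝ} (hd : 1 ≤ Module.finrank ℝ E) (hc : c < Module.finrank ℝ E) :
    ∫⁻ x, (Metric.ball (0 : E) 1).indicator (fun x => ‖x‖ₑ ^ (-c)) x ∂μ < ∞ := by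
  have : Nontrivial E := Module.nontrivial_of_finrank_pos (R := ℝ) (by positivity)
  have h : IntegrableOn (fun x : E => ‖x‖ ^ (-c)) (Metric.ball 0 1) μ :=
    integrableOn_ball_of_norm_le_rpow hd (C := 1) hc
      (Filter.Eventually.of_forall fun x => by
        rw [one_mul, Real.norm_of_nonneg (by positivity)])
      (by fun_prop : Measurable fun x : E => ‖x‖ ^ (-c)).aestronglyMeasurable
  rw [lintegral_indicator Metric.isOpen_ball.measurableSet]
  refine lt_of_eq_of_lt (setLIntegral_congr_fun_ae Metric.isOpen_ball.measurableSet ?_) h.2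
  have h0 : ∀ᵐ x : E ∂μ, x ≠ 0 := by
    simp [ae_iff]
  filter_upwards [h0] with x hx _
  rw [← ofReal_norm, ENNReal.ofReal_rpow_of_pos (norm_pos_iff.2 hx), ← ofReal_norm,
    Real.norm_of_nonneg (by positivity)]

theorem lintegral_compl_ball_rpow_neg_lt_top {a : ℝ} (ha : 1 < a) :
    ∫⁻ t : ℝ, (Metric.ball (0 : ℝ) 1)ᶜ.indicator (fun t => ‖t‖ₑ ^ (-a)) t < ∞ := by
  have h := finite_integral_one_add_norm (E := ℝ) (μ := volume) (r := a) (by simpa using ha)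
  refine lt_of_le_of_lt (lintegral_mono (g := fun t => ENNReal.ofReal (2 ^ a) *
    ENNReal.ofReal ((1 + ‖t‖) ^ (-a))) fun t => ?_) ?_
  · refine Set.indicator_le' (s := (Metric.ball (0 : ℝ) 1)ᶜ) (f := fun t => ‖t‖ₑ ^ (-a))
      (g := fun t => ENNReal.ofReal (2 ^ a) * ENNReal.ofReal ((1 + ‖t‖) ^ (-a)))
      (fun t ht => ?_) (fun _ _ => zero_le) t
    have ht1 : 1 ≤ ‖t‖ := by simpa using ht
    change ‖t‖ₑ ^ (-a) ≤ ENNReal.ofReal (2 ^ a) * ENNReal.ofReal ((1 + ‖t‖) ^ (-a))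
    rw [← ENNReal.ofReal_mul (by positivity), ← ofReal_norm,
      ENNReal.ofReal_rpow_of_pos (by linarith)]
    refine ENNReal.ofReal_le_ofReal ?_
    have h2 : (2 * ‖t‖) ^ (-a) ≤ (1 + ‖t‖) ^ (-a) :=
      Real.rpow_le_rpow_of_nonpos (by positivity) (by linarith) (by linarith)
    calc ‖t‖ ^ (-a) = 2 ^ a * (2 * ‖t‖) ^ (-a) := by
          rw [Real.mul_rpow (by norm_num) (by positivity), ← mul_assoc,
            ← Real.rpow_add (by norm_num), add_neg_cancel, Real.rpow_zero, one_mul]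
      _ ≤ _ := by gcongr
  · rw [lintegral_const_mul' _ _ ENNReal.ofReal_ne_top]
    exact ENNReal.mul_lt_top ENNReal.ofReal_lt_top h

/-! ### The weight -/

/-- The weight `d ^ (-g) |z| ^ (-b)`. -/
noncomputable def weight (g b : ℝ) (ξ : Heis n) : ℝ≥0∞ :=
  ENNReal.ofReal (gauge ξ) ^ (-g) * ENNReal.ofReal (horiz ξ) ^ (-b)

@[fun_prop]
theorem measurable_weight (g b : ℝ) : Measurable (weight g b : Heis n → ℝ≥0∞) := by
  unfold weight
  fun_prop

theorem weight_dilation {g b r : ℝ} (hr : 0 < r) (ξ : Heis n) :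
    weight g b (dilation r ξ) = ENNReal.ofReal r ^ (-(g + b)) * weight g b ξ := by
  have hr0 : ENNReal.ofReal r ≠ 0 := (ENNReal.ofReal_pos.2 hr).ne'
  rw [weight, weight, gauge_dilation hr.le, horiz_dilation hr.le, ENNReal.ofReal_mul hr.le,
    ENNReal.ofReal_mul hr.le, neg_add, ENNReal.rpow_add _ _ hr0 ENNReal.ofReal_ne_top]
  have hmul : ∀ (x : ℝ) (u : ℝ), (ENNReal.ofReal r * ENNReal.ofReal x) ^ u =
      ENNReal.ofReal r ^ u * ENNReal.ofReal x ^ u := by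
    intro x u
    exact ENNReal.mul_rpow_of_ne_top ENNReal.ofReal_ne_top ENNReal.ofReal_ne_top u
  rw [hmul, hmul]
  ring

theorem weight_eq_inv {g b : ℝ} (hg : 0 ≤ g) (hb : 0 ≤ b) (ξ : Heis n) :
    weight g b ξ = (ENNReal.ofReal (gauge ξ) ^ g * ENNReal.ofReal (horiz ξ) ^ b)⁻¹ := by
  rw [weight, ENNReal.mul_inv, ENNReal.rpow_neg, ENNReal.rpow_neg]
  · exact .inr (ENNReal.rpow_ne_top_of_nonneg hb ENNReal.ofReal_ne_top)
  · exact .inl (ENNReal.rpow_ne_top_of_nonneg hg ENNReal.ofReal_ne_top)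

/-- The factor `d ^ (-μ)` of the weight is bounded through `|t| ≤ d²`, the rest through `|z| ≤ d` and
`|x|, |y| ≤ |z|`; the result is a product of functions of `x`, `y` and `t`. -/
theorem weight_le_prod {g b μ c : ℝ} (hg : 0 ≤ g) (hb : 0 ≤ b) (hμ : 0 ≤ μ) (hμg : μ ≤ g)
    (hc : g + b = μ + 2 * c) (ξ : Heis n) :
    weight g b ξ ≤ ‖ξ.1‖ₑ ^ (-c) * (‖ξ.2.1‖ₑ ^ (-c) * ‖ξ.2.2‖ₑ ^ (-(μ / 2))) := by
  have hc0 : 0 ≤ c := by linarith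
  have hT : ‖ξ.2.2‖ₑ ≤ ENNReal.ofReal (gauge ξ) ^ (2 : ℝ) := by
    rw [← ofReal_norm, ENNReal.ofReal_rpow_of_nonneg (gauge_nonneg ξ) two_pos.le, Real.rpow_two]
    exact ENNReal.ofReal_le_ofReal (abs_le_gauge_sq ξ)
  have hX : ‖ξ.1‖ₑ ≤ ENNReal.ofReal (horiz ξ) := by
    rw [← ofReal_norm]
    exact ENNReal.ofReal_le_ofReal (norm_fst_le_horiz ξ)
  have hY : ‖ξ.2.1‖ₑ ≤ ENNReal.ofReal (horiz ξ) := by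
    rw [← ofReal_norm]
    exact ENNReal.ofReal_le_ofReal (norm_snd_le_horiz ξ)
  have hZ : ENNReal.ofReal (horiz ξ) ≤ ENNReal.ofReal (gauge ξ) :=
    ENNReal.ofReal_le_ofReal (horiz_le_gauge ξ)
  have key : ‖ξ.1‖ₑ ^ c * (‖ξ.2.1‖ₑ ^ c * ‖ξ.2.2‖ₑ ^ (μ / 2)) ≤
      ENNReal.ofReal (gauge ξ) ^ g * ENNReal.ofReal (horiz ξ) ^ b := by
    set D := ENNReal.ofReal (gauge ξ)
    set Z := ENNReal.ofReal (horiz ξ)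
    calc ‖ξ.1‖ₑ ^ c * (‖ξ.2.1‖ₑ ^ c * ‖ξ.2.2‖ₑ ^ (μ / 2))
        ≤ Z ^ c * (Z ^ c * (D ^ (2 : ℝ)) ^ (μ / 2)) := by gcongr
      _ = D ^ μ * (Z ^ (g - μ) * Z ^ b) := by
          rw [← ENNReal.rpow_mul, ← ENNReal.rpow_add_of_nonneg _ _ (by linarith) hb,
            ← mul_assoc, ← ENNReal.rpow_add_of_nonneg _ _ hc0 hc0, mul_comm]
          congr 2
          · ring
          · linarith
      _ ≤ D ^ μ * (D ^ (g - μ) * Z ^ b) := by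
          gcongr
      _ = D ^ g * Z ^ b := by
          rw [← mul_assoc, ← ENNReal.rpow_add_of_nonneg _ _ hμ (by linarith), add_sub_cancel]
  rw [weight_eq_inv hg hb]
  refine (ENNReal.inv_le_inv.2 key).trans_eq ?_
  have ht : ∀ {x : ℝ≥0∞} {u : ℝ}, x ≠ ∞ → 0 ≤ u → x ^ u ≠ ∞ :=
    fun hx hu => ENNReal.rpow_ne_top_of_nonneg hu hx
  rw [ENNReal.mul_inv (.inr (ENNReal.mul_ne_top (ht enorm_ne_top hc0)
      (ht enorm_ne_top (by positivity)))) (.inl (ht enorm_ne_top hc0)),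
    ENNReal.mul_inv (.inr (ht enorm_ne_top (by positivity))) (.inl (ht enorm_ne_top hc0)),
    ENNReal.rpow_neg, ENNReal.rpow_neg, ENNReal.rpow_neg]

theorem horiz_lt_one_of_one_lt_weight {g b : ℝ} (hg : 0 ≤ g) (hb : 0 ≤ b) {ξ : Heis n}
    (h : 1 < weight g b ξ) : horiz ξ < 1 := by
  by_contra! hz
  refine absurd h (not_lt.2 ?_)
  rw [weight_eq_inv hg hb, ENNReal.inv_le_one]
  have h1 : 1 ≤ ENNReal.ofReal (horiz ξ) := by simpa using ENNReal.ofReal_le_ofReal hz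
  have h2 : 1 ≤ ENNReal.ofReal (gauge ξ) :=
    h1.trans (ENNReal.ofReal_le_ofReal (horiz_le_gauge ξ))
  exact one_le_mul (by simpa using ENNReal.rpow_le_rpow h2 hg)
    (by simpa using ENNReal.rpow_le_rpow h1 hb)

theorem weight_le_weight_mul {g b u : ℝ} (hg : 0 ≤ g) (hb : 0 ≤ b) (hu : 1 ≤ u) {ξ : Heis n}
    (h : 1 < weight g b ξ) : weight g b ξ ≤ weight (u * g) (u * b) ξ := by
  have hu0 : 0 ≤ u := by linarith
  have h1 : weight (u * g) (u * b) ξ = weight g b ξ ^ u := by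
    rw [weight_eq_inv hg hb, weight_eq_inv (by positivity) (by positivity), ENNReal.inv_rpow,
      ENNReal.mul_rpow_of_nonneg _ _ hu0, ← ENNReal.rpow_mul, ← ENNReal.rpow_mul, mul_comm g,
      mul_comm b]
  rw [h1]
  simpa using ENNReal.rpow_le_rpow_of_exponent_le h.le hu

/-- The weight is integrable over the set where it exceeds `1`. This set is unbounded: along the
axis `z = 0` it narrows like `|z| ^ b < |t| ^ (-g / 2)`, and `g ≥ 2` makes it narrow fast enough.
For `|t| ≥ 1` the weight is replaced there by a slightly higher power of itself, which decays
integrably in `t`. -/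
theorem lintegral_weight_lt_top (hn : 1 ≤ n) {g b : ℝ} (hg : 2 ≤ g) (hb : 0 ≤ b)
    (hgb : g + b < Q n) :
    ∫⁻ ξ : Heis n, {ξ | 1 < weight g b ξ}.indicator (weight g b) ξ < ∞ := by
  have hn' : (1 : ℝ) ≤ n := by exact_mod_cast hn
  have hQ : Q n = 2 * n + 2 := rfl
  have hb2 : b < 2 * n := by linarith
  -- for `|t| < 1` the power of `d` spent on `t` has to be integrable at `t = 0`, and what is left
  -- for `z` integrable at `z = 0`
  obtain ⟨μ, hμ1, hμ2⟩ := exists_between (show max 0 (g + b - 2 * n) < 2 by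
    rw [max_lt_iff]; constructor <;> linarith)
  obtain ⟨hμ0, hμ1⟩ := max_lt_iff.1 hμ1
  -- for `|t| ≥ 1` the weight is raised to a power `u > 1`
  obtain ⟨u, hu1, hub⟩ : ∃ u : ℝ, 1 < u ∧ u * b < 2 * n := by
    rcases hb.eq_or_lt with rfl | hb0
    · exact ⟨2, by norm_num, by linarith⟩
    · obtain ⟨u, h1, h2⟩ := exists_between ((one_lt_div hb0).2 hb2)
      exact ⟨u, h1, (lt_div_iff₀ hb0).1 h2⟩
  set c := (g + b - μ) / 2 with hc
  set P : ℝ → EuclideanSpace ℝ (Fin n) → ℝ≥0∞ := fun c =>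
    (Metric.ball 0 1).indicator (fun x => ‖x‖ₑ ^ (-c)) with hP
  set T₁ : ℝ → ℝ≥0∞ := (Metric.ball 0 1).indicator (fun t => ‖t‖ₑ ^ (-(μ / 2))) with hT₁
  set T₂ : ℝ → ℝ≥0∞ := (Metric.ball 0 1)ᶜ.indicator (fun t => ‖t‖ₑ ^ (-(u * g / 2))) with hT₂
  have hball : ∀ {E : Type} [NormedAddCommGroup E] [MeasurableSpace E] [BorelSpace E],
      MeasurableSet (Metric.ball (0 : E) 1) := fun {E} _ _ _ => Metric.isOpen_ball.measurableSet
  have hPm : ∀ c, Measurable (P c) := fun c => (by fun_prop : Measurable _).indicator hball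
  have hT₁m : Measurable T₁ := (by fun_prop : Measurable _).indicator hball
  have hT₂m : Measurable T₂ := (by fun_prop : Measurable _).indicator hball.compl
  have hPfin : ∀ c : ℝ, c < n → ∫⁻ x, P c x < ∞ := fun c hc =>
    lintegral_ball_rpow_neg_lt_top volume (by simpa using hn) (by simpa using hc)
  have hT₁fin : ∫⁻ t, T₁ t < ∞ :=
    lintegral_ball_rpow_neg_lt_top volume (by simp) (by simp; linarith)
  have hT₂fin : ∫⁻ t, T₂ t < ∞ := lintegral_compl_ball_rpow_neg_lt_top (by nlinarith)
  have hprod : ∀ (c : ℝ) (T : ℝ → ℝ≥0∞), c < n → Measurable T → ∫⁻ t, T t < ∞ →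
      ∫⁻ ξ : Heis n, P c ξ.1 * (P c ξ.2.1 * T ξ.2.2) < ∞ := by
    intro c T hc hT hTfin
    rw [Measure.volume_eq_prod, lintegral_prod_mul (f := P c)
      (g := fun η : EuclideanSpace ℝ (Fin n) × ℝ => P c η.1 * T η.2) (hPm c).aemeasurable
      (by have := hPm c; fun_prop), Measure.volume_eq_prod,
      lintegral_prod_mul (hPm c).aemeasurable hT.aemeasurable]
    exact ENNReal.mul_lt_top (hPfin c hc) (ENNReal.mul_lt_top (hPfin c hc) hTfin)
  refine lt_of_le_of_lt (lintegral_mono (g := fun ξ : Heis n =>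
    P c ξ.1 * (P c ξ.2.1 * T₁ ξ.2.2) +
      P (u * b / 2) ξ.1 * (P (u * b / 2) ξ.2.1 * T₂ ξ.2.2)) fun ξ => ?_) ?_
  · by_cases hξ : 1 < weight g b ξ
    · rw [Set.indicator_of_mem (by exact hξ)]
      have hz := horiz_lt_one_of_one_lt_weight (by linarith) hb hξ
      have hx : ξ.1 ∈ Metric.ball 0 1 := by
        rw [mem_ball_zero_iff]
        exact (norm_fst_le_horiz ξ).trans_lt hz
      have hy : ξ.2.1 ∈ Metric.ball 0 1 := by
        rw [mem_ball_zero_iff]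
        exact (norm_snd_le_horiz ξ).trans_lt hz
      simp only [hP, Set.indicator_of_mem hx, Set.indicator_of_mem hy]
      by_cases ht : ξ.2.2 ∈ Metric.ball (0 : ℝ) 1
      · rw [hT₁, Set.indicator_of_mem ht]
        exact le_add_right (weight_le_prod (by linarith) hb hμ0.le (by linarith)
          (by rw [hc]; ring) ξ)
      · rw [hT₂, Set.indicator_of_mem (by exact ht)]
        refine le_add_left ((weight_le_weight_mul (by linarith) hb hu1.le hξ).trans ?_)
        exact weight_le_prod (by nlinarith) (by positivity) (by nlinarith) le_rfl (by ring) ξ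
    · rw [Set.indicator_of_notMem (by exact hξ)]
      exact zero_le
  · rw [lintegral_add_left]
    · exact ENNReal.add_lt_top.2 ⟨hprod c T₁ (by rw [hc]; linarith) hT₁m hT₁fin,
        hprod (u * b / 2) T₂ (by linarith) hT₂m hT₂fin⟩
    · have := hPm c
      fun_prop

/-- The weight belongs to weak `L ^ (Q / (g + b))`, in the form of a bound for its integral over an
arbitrary set of finite measure. -/
theorem exists_setLIntegral_weight_le (hn : 1 ≤ n) {g b : ℝ} (hg : 2 ≤ g) (hb : 0 ≤ b)
    (hgb : g + b < Q n) :
    ∃ C : ℝ≥0, ∀ E : Set (Heis n), volume E ≠ ∞ →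
      ∫⁻ ξ in E, weight g b ξ ≤ C * volume E ^ (1 - (g + b) / Q n) := by
  set K := ∫⁻ ξ : Heis n, {ξ | 1 < weight g b ξ}.indicator (weight g b) ξ with hKdef
  have hK : K ≠ ∞ := (lintegral_weight_lt_top hn hg hb hgb).ne
  refine ⟨(1 + K).toNNReal, fun E hE => ?_⟩
  rw [ENNReal.coe_toNNReal (ENNReal.add_ne_top.2 ⟨ENNReal.one_ne_top, hK⟩)]
  rcases eq_or_ne (volume E) 0 with h0 | h0
  · rw [Measure.restrict_eq_zero.2 h0, lintegral_zero_measure]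
    exact zero_le
  have hQ := Q_pos (n := n)
  set V := volume E
  set e := g + b
  -- `r` is the radius at which balls have measure comparable to that of `E`
  set r := (V ^ (1 / Q n)).toReal with hr
  have hVpos : V ^ (1 / Q n) ≠ 0 := (ENNReal.rpow_pos (pos_iff_ne_zero.2 h0) hE).ne'
  have hVtop : V ^ (1 / Q n) ≠ ∞ := ENNReal.rpow_ne_top_of_nonneg (by positivity) hE
  have hr0 : 0 < r := ENNReal.toReal_pos hVpos hVtop
  have hrV : ENNReal.ofReal r = V ^ (1 / Q n) := ENNReal.ofReal_toReal hVtop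
  have hrQ : ENNReal.ofReal r ^ Q n = V := by
    rw [hrV, ← ENNReal.rpow_mul, one_div_mul_cancel hQ.ne', ENNReal.rpow_one]
  set h := ENNReal.ofReal r ^ (-e) with hh
  have hhpos : h ≠ 0 :=
    (ENNReal.rpow_pos (ENNReal.ofReal_pos.2 hr0) ENNReal.ofReal_ne_top).ne'
  have hhtop : h ≠ ∞ :=
    ENNReal.rpow_ne_top_of_ne_zero (ENNReal.ofReal_pos.2 hr0).ne' ENNReal.ofReal_ne_top
  have hVh : V * h = V ^ (1 - e / Q n) := by
    rw [hh, hrV, ← ENNReal.rpow_mul]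
    conv_lhs => rw [← ENNReal.rpow_one V, ← ENNReal.rpow_mul, ← ENNReal.rpow_add _ _ h0 hE]
    congr 1
    ring
  have hmeas : ∀ c, MeasurableSet {ξ : Heis n | c < weight g b ξ} := fun c =>
    measurableSet_lt measurable_const (measurable_weight g b)
  have hscale : ∫⁻ ξ : Heis n, {ξ | h < weight g b ξ}.indicator (weight g b) ξ = V * (h * K) := by
    rw [lintegral_comp_dilation hr0 ((measurable_weight g b).indicator (hmeas h)), hrQ, hKdef,
      ← lintegral_const_mul' _ _ hhtop]
    congr 1
    refine lintegral_congr fun ξ => ?_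
    simp only [Set.indicator_apply, Set.mem_ofPred_eq, weight_dilation hr0]
    change (if h < h * weight g b ξ then h * weight g b ξ else 0) = _
    have : h < h * weight g b ξ ↔ 1 < weight g b ξ := by
      conv_lhs => rw [← mul_one h, mul_assoc, one_mul]
      exact ENNReal.mul_lt_mul_iff_right hhpos hhtop
    simp only [this, mul_ite, mul_zero]
  calc ∫⁻ ξ in E, weight g b ξ
      ≤ ∫⁻ ξ in E, (h + {ξ | h < weight g b ξ}.indicator (weight g b) ξ) := by
        refine lintegral_mono fun ξ => ?_
        by_cases hξ : h < weight g b ξ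
        · rw [Set.indicator_of_mem (by exact hξ)]
          exact le_add_self
        · exact (not_lt.1 hξ).trans le_self_add
    _ ≤ h * V + ∫⁻ ξ, {ξ | h < weight g b ξ}.indicator (weight g b) ξ := by
        rw [lintegral_add_left measurable_const, setLIntegral_const]
        gcongr
        exact Measure.restrict_le_self
    _ = (1 + K) * V ^ (1 - e / Q n) := by
        rw [hscale, ← hVh]
        ring

/-! ### Gauge balls -/

theorem measurePreserving_op_inv (ξ : Heis n) :
    MeasurePreserving (fun η : Heis n => op (inv ξ) η) := by
  have h1 : MeasurePreserving (fun x : EuclideanSpace ℝ (Fin n) => (inv ξ).1 + x) :=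
    measurePreserving_add_left volume _
  have h2 : MeasurePreserving (fun y : EuclideanSpace ℝ (Fin n) => (inv ξ).2.1 + y) :=
    measurePreserving_add_left volume _
  have hshear : ∀ x : EuclideanSpace ℝ (Fin n),
      MeasurePreserving (fun η : EuclideanSpace ℝ (Fin n) × ℝ => ((inv ξ).2.1 + η.1,
        (inv ξ).2.2 + η.2 + 2 * inner ℝ (inv ξ).2.1 x - 2 * inner ℝ (inv ξ).1 η.1)) := by
    intro x
    refine MeasurePreserving.skew_product (f := fun y => (inv ξ).2.1 + y)
      (g := fun y t => (inv ξ).2.2 + t + 2 * inner ℝ (inv ξ).2.1 x - 2 * inner ℝ (inv ξ).1 y)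
      h2 (by unfold Function.uncurry; fun_prop) (Filter.Eventually.of_forall fun y => ?_)
    have h := (measurePreserving_add_left (volume : Measure ℝ)
      ((inv ξ).2.2 + 2 * inner ℝ (inv ξ).2.1 x - 2 * inner ℝ (inv ξ).1 y)).map_eq
    refine (congrArg (fun φ : ℝ → ℝ => Measure.map φ volume) (funext fun t => ?_)).trans h
    ring
  exact MeasurePreserving.skew_product (f := fun x => (inv ξ).1 + x)
    (g := fun x (η : EuclideanSpace ℝ (Fin n) × ℝ) => ((inv ξ).2.1 + η.1,
      (inv ξ).2.2 + η.2 + 2 * inner ℝ (inv ξ).2.1 x - 2 * inner ℝ (inv ξ).1 η.1))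
    h1 (by unfold Function.uncurry; fun_prop)
    (Filter.Eventually.of_forall fun x => (hshear x).map_eq)

theorem horiz_op_inv (ξ η : Heis n) : horiz (op (inv ξ) η) = horiz (ξ - η) := by
  simp only [horiz, op, inv, Prod.fst_neg, Prod.snd_neg, Prod.fst_sub, Prod.snd_sub]
  rw [neg_add_eq_sub, neg_add_eq_sub, norm_sub_rev, norm_sub_rev ξ.2.1]

theorem measurableSet_gauge_ball (ξ : Heis n) (r : ℝ) :
    MeasurableSet {η : Heis n | gauge (op (inv ξ) η) < r} :=
  measurableSet_lt (measurable_gauge.comp (measurePreserving_op_inv ξ).measurable)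
    measurable_const

theorem exists_le_volume_gauge_ball (n : ℕ) :
    ∃ c : ℝ≥0∞, c ≠ 0 ∧ c ≠ ∞ ∧ ∀ (ξ : Heis n) {r : ℝ}, 0 < r →
      c * ENNReal.ofReal r ^ Q n ≤ volume {η : Heis n | gauge (op (inv ξ) η) < r} := by
  set v := volume (Metric.ball (0 : EuclideanSpace ℝ (Fin n)) (1 / 2)) with hv
  have hv0 : v ≠ 0 := (Metric.measure_ball_pos volume _ (by norm_num)).ne'
  have hvt : v ≠ ∞ := measure_ball_lt_top.ne
  refine ⟨v * v, mul_ne_zero hv0 hv0, ENNReal.mul_ne_top hvt hvt, fun ξ r hr => ?_⟩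
  set B : Set (Heis n) := Metric.ball 0 (r * (1 / 2)) ×ˢ
    (Metric.ball 0 (r * (1 / 2)) ×ˢ Metric.ball 0 (r ^ 2 * (1 / 2))) with hB
  have hBvol : volume B = v * v * ENNReal.ofReal r ^ Q n := by
    have ht : volume (Metric.ball (0 : ℝ) (r ^ 2 * (1 / 2))) = ENNReal.ofReal (r ^ 2) := by
      rw [Real.volume_ball]
      congr 1
      ring
    rw [hB, Measure.volume_eq_prod, Measure.prod_prod, Measure.volume_eq_prod, Measure.prod_prod,
      Measure.addHaar_ball_mul_of_pos volume _ hr, ht, finrank_euclideanSpace_fin, ofReal_rpow_Q hr]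
    ring
  have hsub : B ⊆ {η : Heis n | gauge η < r} := by
    rintro ⟨x, y, t⟩ ⟨hx, hy, ht⟩
    rw [mem_ball_zero_iff] at hx hy ht
    refine lt_of_pow_lt_pow_left₀ 4 hr.le ?_
    have hz : horiz (x, y, t) ^ 2 ≤ r ^ 2 / 2 := by
      rw [horiz_sq]
      have h1 : ‖x‖ ^ 2 ≤ (r * (1 / 2)) ^ 2 := by gcongr
      have h2 : ‖y‖ ^ 2 ≤ (r * (1 / 2)) ^ 2 := by gcongr
      change ‖x‖ ^ 2 + ‖y‖ ^ 2 ≤ _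
      linarith
    have h3 : t ^ 2 ≤ (r ^ 2 * (1 / 2)) ^ 2 := by
      rw [← sq_abs]
      exact pow_le_pow_left₀ (abs_nonneg t) ht.le 2
    have h4 : (horiz (x, y, t) ^ 2) ^ 2 ≤ (r ^ 2 / 2) ^ 2 := by gcongr
    rw [gauge_pow_four]
    change horiz (x, y, t) ^ 4 + t ^ 2 < r ^ 4
    nlinarith [pow_pos hr 4]
  calc v * v * ENNReal.ofReal r ^ Q n = volume B := hBvol.symm
    _ ≤ volume {η : Heis n | gauge η < r} := measure_mono hsub
    _ = volume {η : Heis n | gauge (op (inv ξ) η) < r} :=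
      ((measurePreserving_op_inv ξ).measure_preimage
        (measurableSet_lt measurable_gauge measurable_const).nullMeasurableSet).symm

/-! ### The fractional energy of a layer -/

/-- The density `ξ ↦ ∫ |f(ξ) - f(ξ')|^p / (d(ξ⁻¹ ∘ ξ')^{Q+ps} |z - z'|^{(p-2)α}) dξ'` whose integral
is the `p`-th power of the fractional seminorm. -/
noncomputable def energyDensity (s p α : ℝ) (f : Heis n → ℝ) (ξ : Heis n) : ℝ≥0∞ :=
  ∫⁻ ξ' : Heis n, ‖f ξ - f ξ'‖ₑ ^ p /
    (ENNReal.ofReal (gauge (op (inv ξ) ξ')) ^ (Q n + p * s) *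
      ENNReal.ofReal (horiz (ξ - ξ')) ^ ((p - 2) * α))

/-- If `|f ξ|` exceeds twice the level `a`, then at least half of a ball of volume
`2 |{|f| > a}|` around `ξ` consists of points where `f` differs from `f ξ` by at least `a`. -/
theorem exists_rpow_le_energyDensity (n : ℕ) {s p α : ℝ} (hp : 0 < p) (hs : 0 < s)
    (hα : 0 ≤ (p - 2) * α) :
    ∃ C : ℝ≥0∞, C ≠ ∞ ∧ ∀ (f : Heis n → ℝ), Measurable f → ∀ (a : ℝ≥0∞) (ξ : Heis n),
      a ≠ ∞ → 2 * a < ‖f ξ‖ₑ → volume {η | a < ‖f η‖ₑ} ≠ 0 → volume {η | a < ‖f η‖ₑ} ≠ ∞ →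
      a ^ p ≤ C * volume {η | a < ‖f η‖ₑ} ^ ((p * s + (p - 2) * α) / Q n) *
        energyDensity s p α f ξ := by
  obtain ⟨c, hc0, hct, hc⟩ := exists_le_volume_gauge_ball n
  have hQ := Q_pos (n := n)
  set β := (p - 2) * α
  set e := (p * s + β) / Q n with he
  have he0 : 0 ≤ e := by positivity
  have h2c : 2 / c ≠ ∞ := ENNReal.div_ne_top ENNReal.ofNat_ne_top hc0
  have h2c0 : 2 / c ≠ 0 := ENNReal.div_ne_zero.2 ⟨two_ne_zero, hct⟩
  refine ⟨(2 / c) ^ (1 + e), ENNReal.rpow_ne_top_of_nonneg (by positivity) h2c,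
    fun f hf a ξ ha hξ hm0 hmt => ?_⟩
  set m := volume {η | a < ‖f η‖ₑ} with hm
  -- the radius `r` is chosen so that balls of radius `r` have volume at least `2 * m`
  set v := 2 / c * m with hv
  have hv0 : v ≠ 0 := mul_ne_zero h2c0 hm0
  have hvt : v ≠ ∞ := ENNReal.mul_ne_top h2c hmt
  set r := (v ^ (1 / Q n)).toReal with hr
  have hrt : v ^ (1 / Q n) ≠ ∞ := ENNReal.rpow_ne_top_of_nonneg (by positivity) hvt
  have hr0 : 0 < r :=
    ENNReal.toReal_pos (ENNReal.rpow_pos (pos_iff_ne_zero.2 hv0) hvt).ne' hrt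
  have hrv : ENNReal.ofReal r = v ^ (1 / Q n) := ENNReal.ofReal_toReal hrt
  have hrQ : ENNReal.ofReal r ^ Q n = v := by
    rw [hrv, ← ENNReal.rpow_mul, one_div_mul_cancel hQ.ne', ENNReal.rpow_one]
  have hcv : c * v = 2 * m := by
    rw [hv, ← mul_assoc, ENNReal.mul_div_cancel hc0 hct]
  set R := ENNReal.ofReal r ^ (Q n + p * s + β) with hR
  have hRv : R = (2 / c) ^ (1 + e) * m ^ e * m := by
    rw [hR, hrv, ← ENNReal.rpow_mul, show 1 / Q n * (Q n + p * s + β) = 1 + e by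
      rw [he]; field_simp; ring, hv, ENNReal.mul_rpow_of_nonneg _ _ (by positivity), mul_assoc]
    congr 1
    rw [add_comm, ENNReal.rpow_add_of_nonneg _ _ he0 zero_le_one, ENNReal.rpow_one]
  have hR0 : R ≠ 0 := (ENNReal.rpow_pos (ENNReal.ofReal_pos.2 hr0) ENNReal.ofReal_ne_top).ne'
  have hRt : R ≠ ∞ := ENNReal.rpow_ne_top_of_nonneg (by positivity) ENNReal.ofReal_ne_top
  set S := {η : Heis n | gauge (op (inv ξ) η) < r} \ {η | a < ‖f η‖ₑ} with hS
  have hSm : MeasurableSet S := (measurableSet_gauge_ball ξ r).diff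
    (measurableSet_lt measurable_const hf.enorm)
  have hSvol : m ≤ volume S := by
    have h1 := hc ξ hr0
    rw [hrQ, hcv, two_mul] at h1
    calc m = m + m - m := (ENNReal.add_sub_cancel_right hmt).symm
      _ ≤ volume {η : Heis n | gauge (op (inv ξ) η) < r} - m := tsub_le_tsub_right h1 _
      _ ≤ volume S := le_measure_sdiff
  have hpt : ∀ η ∈ S, a ^ p ≤ R * (‖f ξ - f η‖ₑ ^ p /
      (ENNReal.ofReal (gauge (op (inv ξ) η)) ^ (Q n + p * s) *
        ENNReal.ofReal (horiz (ξ - η)) ^ β)) := by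
    rintro η ⟨hη, hfη⟩
    have hη' : gauge (op (inv ξ) η) ≤ r := le_of_lt hη
    have hfη' : ‖f η‖ₑ ≤ a := not_lt.1 hfη
    have hdiff : a ≤ ‖f ξ - f η‖ₑ := by
      have h1 : ‖f ξ‖ₑ ≤ ‖f ξ - f η‖ₑ + ‖f η‖ₑ := by
        simpa using enorm_add_le (f ξ - f η) (f η)
      have h2 : a + a ≤ ‖f ξ - f η‖ₑ + a :=
        (two_mul a ▸ hξ.le).trans (h1.trans (by gcongr))
      exact (ENNReal.add_le_add_iff_right ha).1 h2
    have hden : ENNReal.ofReal (gauge (op (inv ξ) η)) ^ (Q n + p * s) *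
        ENNReal.ofReal (horiz (ξ - η)) ^ β ≤ R := by
      rw [hR, ENNReal.rpow_add_of_nonneg _ _ (by positivity) hα, ← horiz_op_inv]
      have hz : horiz (op (inv ξ) η) ≤ r := (horiz_le_gauge _).trans hη'
      gcongr
    -- valid also where the kernel's denominator vanishes, since `R` is positive and finite
    calc a ^ p ≤ ‖f ξ - f η‖ₑ ^ p := by gcongr
      _ = R * (‖f ξ - f η‖ₑ ^ p / R) := (ENNReal.mul_div_cancel hR0 hRt).symm
      _ ≤ _ := by gcongr
  have hmain : a ^ p * m ≤ (2 / c) ^ (1 + e) * m ^ e * energyDensity s p α f ξ * m := by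
    calc a ^ p * m ≤ a ^ p * volume S := by gcongr
      _ = ∫⁻ _ in S, a ^ p := (setLIntegral_const _ _).symm
      _ ≤ ∫⁻ η in S, R * (‖f ξ - f η‖ₑ ^ p /
            (ENNReal.ofReal (gauge (op (inv ξ) η)) ^ (Q n + p * s) *
              ENNReal.ofReal (horiz (ξ - η)) ^ β)) := setLIntegral_mono' hSm hpt
      _ ≤ R * energyDensity s p α f ξ := by
        rw [lintegral_const_mul' _ _ hRt]
        gcongr
        exact setLIntegral_le_lintegral _ _
      _ = _ := by
        rw [hRv]
        ring
  exact (ENNReal.mul_le_mul_iff_left hm0 hmt).1 hmain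

/-! ### Dyadic layers of a function -/

/-- The dyadic superlevel set `{2 ^ k < |f|}`. -/
def superlevel (f : Heis n → ℝ) (k : ℤ) : Set (Heis n) :=
  {ξ | (2 : ℝ≥0∞) ^ (k : ℝ) < ‖f ξ‖ₑ}

/-- The dyadic layer `{2 ^ k < |f| ≤ 2 ^ (k + 1)}`. -/
def layer (f : Heis n → ℝ) (k : ℤ) : Set (Heis n) :=
  superlevel f k \ superlevel f (k + 1)

theorem measurableSet_superlevel {f : Heis n → ℝ} (hf : Measurable f) (k : ℤ) :
    MeasurableSet (superlevel f k) :=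
  measurableSet_lt measurable_const hf.enorm

theorem measurableSet_layer {f : Heis n → ℝ} (hf : Measurable f) (k : ℤ) :
    MeasurableSet (layer f k) :=
  (measurableSet_superlevel hf k).diff (measurableSet_superlevel hf _)

theorem superlevel_antitone (f : Heis n → ℝ) : Antitone (superlevel f) := by
  intro j k hjk ξ hξ
  refine lt_of_le_of_lt (b := (2 : ℝ≥0∞) ^ (k : ℝ)) ?_ hξ
  exact ENNReal.rpow_le_rpow_of_exponent_le (by norm_num) (by exact_mod_cast hjk)

theorem superlevel_subset (f : Heis n → ℝ) (k : ℤ) :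
    superlevel f k ⊆ layer f k ∪ superlevel f (k + 1) := by
  rw [layer, Set.sdiff_union_self]
  exact Set.subset_union_left

theorem pairwise_disjoint_layer (f : Heis n → ℝ) :
    Pairwise (Function.onFun Disjoint (layer f)) := by
  refine pairwise_disjoint_on (layer f) |>.2 fun j k hjk => ?_
  refine Set.disjoint_left.2 fun ξ hj hk => hj.2 ?_
  exact superlevel_antitone f (Int.add_one_le_of_lt hjk) hk.1

theorem lintegral_eq_tsum_layer {f : Heis n → ℝ} (hf : Measurable f) {F : Heis n → ℝ≥0∞}
    (hF : ∀ ξ, f ξ = 0 → F ξ = 0) :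
    ∫⁻ ξ, F ξ = ∑' k : ℤ, ∫⁻ ξ in layer f k, F ξ := by
  rw [← lintegral_iUnion (measurableSet_layer hf) (pairwise_disjoint_layer f),
    ← lintegral_indicator (MeasurableSet.iUnion (measurableSet_layer hf))]
  refine lintegral_congr fun ξ => ?_
  by_cases h : ξ ∈ ⋃ k, layer f k
  · rw [Set.indicator_of_mem h]
  · rw [Set.indicator_of_notMem h]
    refine hF ξ ?_
    by_contra h0
    obtain ⟨k, hk⟩ := ENNReal.exists_mem_Ioc_zpow (x := ‖f ξ‖ₑ) (y := 2) (by simpa using h0)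
      enorm_ne_top (by norm_num) ENNReal.ofNat_ne_top
    refine h (Set.mem_iUnion.2 ⟨k, ?_, ?_⟩)
    · change (2 : ℝ≥0∞) ^ (k : ℝ) < _
      rw [ENNReal.rpow_intCast]
      exact hk.1
    · change ¬ (2 : ℝ≥0∞) ^ ((k + 1 : ℤ) : ℝ) < _
      rw [ENNReal.rpow_intCast]
      exact not_lt.2 hk.2

theorem tsum_setLIntegral_layer_le {f : Heis n → ℝ} (hf : Measurable f) (F : Heis n → ℝ≥0∞) :
    ∑' k : ℤ, ∫⁻ ξ in layer f k, F ξ ≤ ∫⁻ ξ, F ξ := by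
  rw [← lintegral_iUnion (measurableSet_layer hf) (pairwise_disjoint_layer f)]
  exact setLIntegral_le_lintegral _ _

theorem tsum_volume_layer_le {f : Heis n → ℝ} (hf : Measurable f) {q : ℝ} (hq : 0 ≤ q) :
    ∑' k : ℤ, (2 : ℝ≥0∞) ^ (k * q) * volume (layer f k) ≤ ∫⁻ ξ, ‖f ξ‖ₑ ^ q := by
  refine le_trans (ENNReal.tsum_le_tsum fun k => ?_) (tsum_setLIntegral_layer_le hf _)
  rw [← setLIntegral_const, ENNReal.rpow_mul]
  exact setLIntegral_mono' (measurableSet_layer hf k) fun ξ hξ =>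
    ENNReal.rpow_le_rpow (le_of_lt hξ.1) hq

/-- Against a weight whose integral over `E` is at most `C |E| ^ ω`, the integral of `|f| ^ τ` is
controlled by the measures of the layers of `f` alone. -/
theorem lintegral_mul_rpow_le_tsum_layer {f : Heis n → ℝ} (hf : Measurable f) {τ ω : ℝ}
    (hτ : 0 < τ) {W : Heis n → ℝ≥0∞} {C : ℝ≥0∞}
    (hW : ∀ E : Set (Heis n), volume E ≠ ∞ → ∫⁻ ξ in E, W ξ ≤ C * volume E ^ ω)
    (hfin : ∀ k, volume (layer f k) ≠ ∞) :
    ∫⁻ ξ, W ξ * ‖f ξ‖ₑ ^ τ ≤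
      C * 2 ^ τ * ∑' k : ℤ, (2 : ℝ≥0∞) ^ (k * τ) * volume (layer f k) ^ ω := by
  rw [lintegral_eq_tsum_layer hf (fun ξ h => by simp [h, hτ]), ← ENNReal.tsum_mul_left]
  refine ENNReal.tsum_le_tsum fun k => ?_
  calc ∫⁻ ξ in layer f k, W ξ * ‖f ξ‖ₑ ^ τ
      ≤ ∫⁻ ξ in layer f k, W ξ * 2 ^ ((k + 1) * τ) := by
        refine setLIntegral_mono' (measurableSet_layer hf k) fun ξ hξ => ?_
        rw [ENNReal.rpow_mul]
        have h : ‖f ξ‖ₑ ≤ 2 ^ ((k + 1 : ℤ) : ℝ) := not_lt.1 hξ.2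
        push_cast at h
        gcongr
    _ = (∫⁻ ξ in layer f k, W ξ) * 2 ^ ((k + 1) * τ) :=
        lintegral_mul_const' _ _ (two_rpow_ne_top _)
    _ ≤ (C * volume (layer f k) ^ ω) * 2 ^ ((k + 1) * τ) := by
        gcongr
        exact hW _ (hfin k)
    _ = _ := by
        rw [add_mul, one_mul, two_rpow_add]
        ring

/-- The a priori finiteness that allows dyadic sums to be absorbed: for bounded `f` of compact support
only levels bounded above contribute, and these form a geometric series. -/
theorem tsum_superlevel_ne_top {f : Heis n → ℝ} (hf : Continuous f) (hc : HasCompactSupport f)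
    {τ ω : ℝ} (hτ : 0 < τ) (hω : 0 < ω) :
    ∑' k : ℤ, (2 : ℝ≥0∞) ^ (k * τ) * volume (superlevel f k) ^ ω ≠ ∞ := by
  obtain ⟨M, hM⟩ := hc.exists_bound_of_continuous hf
  obtain ⟨N, hN⟩ := pow_unbounded_of_one_lt M (one_lt_two)
  have hempty : ∀ k : ℤ, (N : ℤ) < k → volume (superlevel f k) = 0 := by
    intro k hk
    convert measure_empty (μ := (volume : Measure (Heis n)))
    refine Set.eq_empty_of_forall_notMem fun ξ hξ => ?_
    have h1 : (2 : ℝ≥0∞) ^ (N : ℝ) < ‖f ξ‖ₑ := superlevel_antitone f hk.le hξ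
    rw [ENNReal.rpow_natCast, ← ofReal_norm] at h1
    have h2 : ENNReal.ofReal ‖f ξ‖ ≤ 2 ^ N := by
      calc ENNReal.ofReal ‖f ξ‖ ≤ ENNReal.ofReal (2 ^ N) :=
            ENNReal.ofReal_le_ofReal ((hM ξ).trans hN.le)
        _ = 2 ^ N := by rw [ENNReal.ofReal_pow two_pos.le, ENNReal.ofReal_ofNat]
    exact absurd h1 (not_lt.2 h2)
  set V := volume (tsupport f) with hV
  have hVt : V ≠ ∞ := hc.isCompact.measure_lt_top.ne
  have hle : ∀ k, volume (superlevel f k) ≤ V := by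
    intro k
    refine measure_mono fun ξ hξ => subset_tsupport f ?_
    intro h0
    have h1 : (2 : ℝ≥0∞) ^ (k : ℝ) < ‖f ξ‖ₑ := hξ
    simp [h0] at h1
  set i : ℕ → ℤ := fun j => N - j with hi
  have hinj : Function.Injective i := fun j k h => by simpa [hi] using h
  rw [← hinj.tsum_eq]
  · have h1 : ∑' j : ℕ, ((2 : ℝ≥0∞) ^ (-τ)) ^ j * (2 ^ (N * τ) * V ^ ω) ≠ ∞ := by
      rw [ENNReal.tsum_mul_right, ENNReal.tsum_geometric]
      exact ENNReal.mul_ne_top (inv_one_sub_two_rpow_neg_ne_top hτ)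
        (ENNReal.mul_ne_top (two_rpow_ne_top _) (ENNReal.rpow_ne_top_of_nonneg hω.le hVt))
    refine ne_top_of_le_ne_top h1 (ENNReal.tsum_le_tsum fun j => ?_)
    have h2 : (2 : ℝ≥0∞) ^ ((i j : ℝ) * τ) = (2 ^ (-τ)) ^ j * 2 ^ (N * τ) := by
      rw [← ENNReal.rpow_natCast, ← ENNReal.rpow_mul, ← two_rpow_add]
      congr 1
      simp only [hi]
      push_cast
      ring
    rw [h2, mul_assoc]
    gcongr
    exact hle _
  · intro k hk
    by_contra hne
    refine hk ?_
    have : (N : ℤ) < k := by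
      by_contra! h
      exact hne ⟨(N - k).toNat, by simp only [hi]; omega⟩
    simp [hempty k this, hω]

/-- The measure of a layer is controlled by the fractional energy of that layer and by a power of the
measure of the superlevel set one dyadic step below. -/
theorem exists_volume_layer_le (n : ℕ) {s p α : ℝ} (hp : 0 < p) (hs : 0 < s)
    (hα : 0 ≤ (p - 2) * α) :
    ∃ C : ℝ≥0∞, C ≠ ∞ ∧ ∀ f : Heis n → ℝ, Measurable f →
      (∀ k, volume (superlevel f k) ≠ ∞) → ∀ k : ℤ,
      volume (layer f k) ≤ C * 2 ^ (-(k * p)) *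
        volume (superlevel f (k - 1)) ^ ((p * s + (p - 2) * α) / Q n) *
          ∫⁻ ξ in layer f k, energyDensity s p α f ξ := by
  obtain ⟨C, hC, h⟩ := exists_rpow_le_energyDensity n hp hs hα
  have hQ := Q_pos (n := n)
  refine ⟨C * 2 ^ p, ENNReal.mul_ne_top hC (two_rpow_ne_top p), fun f hf hfin k => ?_⟩
  have hsub : layer f k ⊆ superlevel f (k - 1) :=
    Set.sdiff_subset.trans (superlevel_antitone f (by omega))
  -- a null superlevel set contains no layer of positive measure, whatever the energy
  rcases eq_or_ne (volume (superlevel f (k - 1))) 0 with h0 | h0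
  · rw [measure_mono_null hsub h0]
    exact zero_le
  set e := (p * s + (p - 2) * α) / Q n with he
  have he0 : 0 ≤ e := by positivity
  set m := volume (superlevel f (k - 1)) with hm
  set a : ℝ≥0∞ := 2 ^ ((k - 1 : ℤ) : ℝ) with ha
  have h2a : 2 * a = 2 ^ (k : ℝ) := by
    rw [ha]
    conv_lhs => rw [← ENNReal.rpow_one 2, ← ENNReal.rpow_mul, ← two_rpow_add]
    push_cast
    ring_nf
  have hap : a ^ p = 2 ^ (k * p) * 2 ^ (-p) := by
    rw [ha, ← ENNReal.rpow_mul, ← two_rpow_add]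
    push_cast
    ring_nf
  have hint : a ^ p * volume (layer f k) ≤
      C * m ^ e * ∫⁻ ξ in layer f k, energyDensity s p α f ξ := by
    rw [← setLIntegral_const, ← lintegral_const_mul' _ _
      (ENNReal.mul_ne_top hC (ENNReal.rpow_ne_top_of_nonneg he0 (hfin _)))]
    refine setLIntegral_mono' (measurableSet_layer hf k) fun ξ hξ => ?_
    exact h f hf a ξ (two_rpow_ne_top _) (h2a ▸ hξ.1) h0 (hfin _)
  calc volume (layer f k)
      = 2 ^ p * 2 ^ (-(k * p)) * (a ^ p * volume (layer f k)) := by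
        rw [hap]
        have h1 : (2 : ℝ≥0∞) ^ p * 2 ^ (-(k * p)) * (2 ^ (k * p) * 2 ^ (-p)) = 1 := by
          rw [← two_rpow_add, ← two_rpow_add, ← two_rpow_add]
          ring_nf
          exact ENNReal.rpow_zero
        rw [← mul_assoc, h1, one_mul]
    _ ≤ 2 ^ p * 2 ^ (-(k * p)) * (C * m ^ e * ∫⁻ ξ in layer f k, energyDensity s p α f ξ) := by
        gcongr
    _ = _ := by ring

end Heis

/-! ### The weighted interpolation inequality -/

open Heis in
theorem theorem1p2 (n : ℕ) (hn : 1 ≤ n) (p s α τ a γ q : ℝ)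
    (hp : 1 < p) (hs0 : 0 < s) (hs1 : s < 1)
    (hα0 : 0 ≤ (p - 2) * α) (hα1 : (p - 2) * α < Heis.Q n - 2)
    (hτ : 1 < τ) (ha0 : 0 < a) (ha1 : a ≤ 1)
    (hq1 : 1 ≤ q) (hq : (1 - a) * τ < q)
    (hbal : 1 / τ + γ * (1 + (p - 2) * α / (p * s)) / Heis.Q n =
      a * (1 / p - s * (1 + (p - 2) * α / (p * s)) / Heis.Q n) + (1 - a) / q)
    (hγ0 : 0 ≤ -γ) (hγ1 : -γ ≤ a * s)
    (hpos : 0 < 1 / τ + γ * (1 + (p - 2) * α / (p * s)) / Heis.Q n)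
    (hτγ : τ * γ ≤ -2)
    (hq2 : (1 - a) * τ * Heis.Q n /
      (Heis.Q n - 2 + τ * γ * ((p - 2) * α / (p * s))) < q) :
    ∃ C : ℝ≥0, ∀ f : Heis n → ℝ, ContDiff ℝ 1 f → HasCompactSupport f →
      Heis.weightedNorm s p α τ γ f ≤
        (C : ℝ≥0∞) * Heis.seminorm s p α f ^ a *
          eLpNorm f (ENNReal.ofReal q) volume ^ (1 - a) := by
  have hQ : 0 < Q n := Q_pos
  have hp0 : 0 < p := by linarith
  have hτ0 : 0 < τ := by linarith
  have hq0 : 0 < q := by linarith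
  set κ := (p - 2) * α / (p * s) with hκ
  have hκ0 : 0 ≤ κ := by positivity
  have hβ : (p - 2) * α = p * s * κ := by rw [hκ]; field_simp
  set g := -(τ * γ) with hg
  set b := -(τ * γ * κ) with hb
  have hg2 : 2 ≤ g := by linarith
  have hgb : b = g * κ := by rw [hb, hg]; ring
  have hb0 : 0 ≤ b := by rw [hgb]; exact mul_nonneg (by linarith) hκ0
  set ω := 1 - (g + b) / Q n with hω
  set A := a * τ / p with hA
  set B := (1 - a) * τ / q with hB
  set e := (p * s + (p - 2) * α) / Q n with he
  have hωτ : ω = τ * (1 / τ + γ * (1 + κ) / Q n) := by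
    rw [hω, hgb, hg]; field_simp; ring
  have hω0 : 0 < ω := by rw [hωτ]; exact mul_pos hτ0 hpos
  have hω1 : ω ≤ 1 := by
    have : 0 ≤ (g + b) / Q n := div_nonneg (by linarith) hQ.le
    linarith
  have hgbQ : g + b < Q n := by
    have : (g + b) / Q n < 1 := by linarith
    rwa [div_lt_one hQ] at this
  have hA0 : 0 < A := by positivity
  have hB0 : 0 ≤ B := div_nonneg (mul_nonneg (by linarith) hτ0.le) hq0.le
  have he0 : 0 ≤ e := by positivity
  -- the balance condition
  have hωe : ω = A + B - e * A := by
    rw [hωτ, hbal, hA, hB, he, hβ]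
    field_simp
    ring
  -- `A + B - 1` is a positive multiple of `γ + a s`
  have hAB : 1 ≤ A + B := by
    have h1 : A + B - 1 = τ * (1 + κ) * (γ + a * s) / Q n := by
      have h2 : A + B = ω + e * A := by linarith
      rw [h2, hωτ, hA, he, hβ]
      field_simp
      ring
    have h3 : 0 ≤ A + B - 1 := by
      rw [h1]
      exact div_nonneg (mul_nonneg (by positivity) (by linarith)) hQ.le
    linarith
  have hτe : p * A + q * B = τ := by
    rw [hA, hB]
    field_simp
    ring
  obtain ⟨C₁, hC₁⟩ := exists_setLIntegral_weight_le hn hg2 hb0 hgbQ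
  obtain ⟨C₂, hC₂t, hC₂⟩ := exists_volume_layer_le n hp0 hs0 hα0
  obtain ⟨K, hK⟩ := exists_tsum_layers_le hτ0 hω0 hω1 hA0 hB0 hAB he0 hτe hωe hC₂t
  set c := (1 - (2 : ℝ≥0∞) ^ (-q))⁻¹ with hc
  have hct : c ≠ ∞ := inv_one_sub_two_rpow_neg_ne_top hq0
  set M : ℝ≥0∞ := C₁ * 2 ^ τ * (K * c ^ B) with hM
  have hMt : M ^ (1 / τ) ≠ ∞ := by
    refine ENNReal.rpow_ne_top_of_nonneg (by positivity) (ENNReal.mul_ne_top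
      (ENNReal.mul_ne_top ENNReal.coe_ne_top (two_rpow_ne_top τ))
      (ENNReal.mul_ne_top ENNReal.coe_ne_top (ENNReal.rpow_ne_top_of_nonneg hB0 hct)))
  refine ⟨(M ^ (1 / τ)).toNNReal, fun f hf hfc => ?_⟩
  rw [ENNReal.coe_toNNReal hMt]
  have hcont := hf.continuous
  have hmeas : Measurable f := hcont.measurable
  have hm_mono : Antitone fun k => volume (superlevel f k) :=
    fun j k hjk => measure_mono (superlevel_antitone f hjk)
  have hd_le : ∀ k, volume (layer f k) ≤ volume (superlevel f k) :=
    fun k => measure_mono Set.sdiff_subset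
  have hm_le : ∀ k, volume (superlevel f k) ≤
      volume (layer f k) + volume (superlevel f (k + 1)) := fun k =>
    (measure_mono (superlevel_subset f k)).trans (measure_union_le _ _)
  have hm_fin : ∀ k, volume (superlevel f k) ≠ ∞ := by
    intro k
    have h1 := ENNReal.ne_top_of_tsum_ne_top (tsum_superlevel_ne_top hcont hfc hτ0 one_pos) k
    rw [ENNReal.rpow_one] at h1
    exact fun h => h1 (by rw [h, ENNReal.mul_top (two_rpow_ne_zero _)])
  set Γ := ∫⁻ ξ, energyDensity s p α f ξ with hΓ
  set I := ∫⁻ ξ, ‖f ξ‖ₑ ^ q with hI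
  have hsum_q : ∑' k : ℤ, (2 : ℝ≥0∞) ^ (k * q) * volume (superlevel f k) ≤ c * I := by
    have h1 := tsum_levels_le_tsum_layers hq0 zero_le_one le_rfl hm_le
      (tsum_superlevel_ne_top hcont hfc hq0 one_pos)
    simp only [ENNReal.rpow_one] at h1
    refine h1.trans ?_
    gcongr
    exact tsum_volume_layer_le hmeas hq0.le
  have hmain : ∫⁻ ξ, weight g b ξ * ‖f ξ‖ₑ ^ τ ≤ M * Γ ^ A * I ^ B := by
    calc ∫⁻ ξ, weight g b ξ * ‖f ξ‖ₑ ^ τ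
        ≤ C₁ * 2 ^ τ * ∑' k : ℤ, (2 : ℝ≥0∞) ^ (k * τ) * volume (layer f k) ^ ω :=
          lintegral_mul_rpow_le_tsum_layer hmeas hτ0 hC₁
            fun k => ne_top_of_le_ne_top (hm_fin k) (hd_le k)
      _ ≤ C₁ * 2 ^ τ * (K * (∑' k : ℤ, ∫⁻ ξ in layer f k, energyDensity s p α f ξ) ^ A *
            (∑' k : ℤ, (2 : ℝ≥0∞) ^ (k * q) * volume (superlevel f k)) ^ B) := by
          gcongr
          exact hK _ _ _ hm_mono hd_le hm_le (hC₂ f hmeas hm_fin)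
            (tsum_superlevel_ne_top hcont hfc hτ0 hω0)
      _ ≤ C₁ * 2 ^ τ * (K * Γ ^ A * (c * I) ^ B) := by
          gcongr
          exact tsum_setLIntegral_layer_le hmeas _
      _ = M * Γ ^ A * I ^ B := by
          rw [ENNReal.mul_rpow_of_nonneg _ _ hB0, hM]
          ring
  have hleft : weightedNorm s p α τ γ f = (∫⁻ ξ, weight g b ξ * ‖f ξ‖ₑ ^ τ) ^ (1 / τ) := by
    simp only [weightedNorm, weight, hg, hb, neg_neg, hκ]
  have hsemi : Heis.seminorm s p α f = Γ ^ (1 / p) := rfl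
  have hLq : eLpNorm f (ENNReal.ofReal q) volume = I ^ (1 / q) := by
    rw [eLpNorm_eq_lintegral_rpow_enorm_toReal (ENNReal.ofReal_pos.2 hq0).ne'
      ENNReal.ofReal_ne_top, ENNReal.toReal_ofReal hq0.le]
  have h1τ : 0 ≤ 1 / τ := by positivity
  rw [hleft, hsemi, hLq, ← ENNReal.rpow_mul, ← ENNReal.rpow_mul]
  refine (ENNReal.rpow_le_rpow hmain h1τ).trans_eq ?_
  rw [ENNReal.mul_rpow_of_nonneg _ _ h1τ, ENNReal.mul_rpow_of_nonneg _ _ h1τ, ← ENNReal.rpow_mul,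
    ← ENNReal.rpow_mul]
  have hAτ : A * (1 / τ) = 1 / p * a := by rw [hA]; field_simp
  have hBτ : B * (1 / τ) = 1 / q * (1 - a) := by rw [hB]; field_simp
  rw [hAτ, hBτ]
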